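/- \textbf{Setting.} Let $\mathcal P^n=\{I,X,Y,Z\}^{\otimes n}$ be the set of the $4^n$ $n$-qubit Pauli matrices. An $n$-qubit \emph{Clifford unitary} is a unitary $U$ on $(\mathbb C^2)^{\otimes n}$ such that $UPU^\dagger\in\pm\mathcal P^n$ for all $P\in\mathcal P^n$. Two unitaries $U,\tilde U$ are \emph{equal as channels} if $U\rho U^\dagger=\tilde U\rho\tilde U^\dagger$ for all density matrices $\rho$. \textbf{The test.} Let $U$ (known) and $\tilde U$ (a black box) be $n$-qubit Clifford unitaries. One run of the test is as follows. Draw $P\in\mathcal P^n$ uniformly at random and compute $Q=U^\dagger PU=s\,Q_1\otimes\cdots\otimes Q_n$, with $s\in\{+1,-1\}$ and $Q_j\in\{I,X,Y,Z\}$. Prepare the product state $|\psi_{in}\rangle$ whose $j$-th qubit is, if $Q_j\in\{X,Y,Z\}$, the $\sigma_j$-eigenstate of $Q_j$ for an independent uniformly random sign $\sigma_j\in\{+1,-1\}$, and, if $Q_j=I$, the state $\frac1{\sqrt2}(|0\rangle+e^{i\pi/4}|1\rangle)$. Put $\lambda=s\prod_{j:Q_j\neq I}\sigma_j$. Apply $\tilde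 U$ once to $|\psi_{in}\rangle$ and measure the $\pm1$-valued observable $P$ on the result. \textbf{Theorem.} Every circuit of Pauli, Hadamard, phase ($S$) and CNOT gates is a Clifford unitary. Moreover, there are absolute constants $c,C>0$ such that for every $n$ and all $n$-qubit Clifford unitaries $U,\tilde U$ the following hold. \begin{enumerate} \item For every $P\in\mathcal P^n$, $U^\dagger PU$ is a signed Pauli $Q$ as used in the test, and $|\psi_{in}\rangle$ is always an eigenstate of $Q$ with eigenvalue $\lambda$. \item If $\tilde U$ and $U$ are equal as channels, then the outcome of a run is the predicted value $\lambda$ with probability $1$; hence in any number of runs the probability that some outcome differs from the predicted one is $0$. \item If $\tilde U$ and $U$ are not equal as channels, then the outcome of a run is $-\lambda$ with probability at least $c$, over the choice of $P$, the random signs and the measurement. Consequently, for every $\delta\in(0,1)$ and every integer $k\ge C\log(1/\delta)$, in $k$ independent runs (each using $\tilde U$ once) some outcome differs from the predicted one with probability at least $1-\delta$. \end{enumerate} -/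

import Mathlib

open Matrix MeasureTheory
open scoped ComplexOrder

namespace CliffordTest

/-- Computational basis labels of an `n`-qubit register: bit strings of length `n`. -/
abbrev Bits (n : ℕ) : Type := Fin n → Fin 2

/-- Complex `2ⁿ × 2ⁿ` matrices. -/
abbrev Op (n : ℕ) : Type := Matrix (Bits n) (Bits n) ℂ

/-- The group of `n`-qubit unitaries. -/
abbrev UnitaryOp (n : ℕ) : Type := Matrix.unitaryGroup (Bits n) ℂ

/-- Names of the four one-qubit Paulis. -/
inductive Pauli : Type
  | I | X | Y | Z
  deriving DecidableEq, Inhabited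

instance : Fintype Pauli where
  elems := {.I, .X, .Y, .Z}
  complete p := by cases p <;> simp

/-- The one-qubit Pauli matrices. -/
noncomputable def Pauli.mat : Pauli → Matrix (Fin 2) (Fin 2) ℂ
  | .I => 1
  | .X => !![0, 1; 1, 0]
  | .Y => !![0, -Complex.I; Complex.I, 0]
  | .Z => !![1, 0; 0, -1]

/-- The tensor product `A₁ ⊗ ⋯ ⊗ Aₙ` of one-qubit matrices. -/
noncomputable def tensor {n : ℕ} (A : Fin n → Matrix (Fin 2) (Fin 2) ℂ) : Op n :=
  Matrix.of fun x y => ∏ j, A j (x j) (y j)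

/-- The `n`-qubit Pauli `P₁ ⊗ ⋯ ⊗ Pₙ`. -/
noncomputable def pauliOp {n : ℕ} (P : Fin n → Pauli) : Op n := tensor fun j => (P j).mat

/-- A sign, as a complex number. -/
abbrev sgn (s : ℤˣ) : ℂ := ((s : ℤ) : ℂ)

/-! ### Clifford circuits and Clifford unitaries -/

/-- Elementary Clifford gates on `n` qubits. -/
inductive Gate (n : ℕ) : Type
  | pauli (p : Pauli) (j : Fin n)
  | hadamard (j : Fin n)
  | phase (j : Fin n)
  | cnot (control target : Fin n) (h : control ≠ target)

/-- The one-qubit matrix `A` acting on qubit `j`, and the identity on the other qubits. -/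
noncomputable def onQubit {n : ℕ} (j : Fin n) (A : Matrix (Fin 2) (Fin 2) ℂ) : Op n :=
  tensor (Function.update (fun _ => 1) j A)

/-- The matrix of a gate. -/
noncomputable def Gate.mat {n : ℕ} : Gate n → Op n
  | .pauli p j => onQubit j p.mat
  | .hadamard j => onQubit j
      !![1 / (√2 : ℂ), 1 / (√2 : ℂ); 1 / (√2 : ℂ), -1 / (√2 : ℂ)]
  | .phase j => onQubit j !![1, 0; 0, Complex.I]
  | .cnot c t _ => Matrix.of fun x y =>
      if x = Function.update y t (y t + y c) then 1 else 0

/-- The matrix of a circuit, a list of gates of which the head is applied first. -/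
noncomputable def circuitMat {n : ℕ} (gates : List (Gate n)) : Op n :=
  gates.foldl (fun M g => g.mat * M) 1

/-- Clifford unitaries: conjugation takes each `n`-qubit Pauli to an `n`-qubit Pauli up to sign. -/
def IsClifford {n : ℕ} (U : Op n) : Prop :=
  U ∈ Matrix.unitaryGroup (Bits n) ℂ ∧
    ∀ P : Fin n → Pauli, ∃ (s : ℤˣ) (Q : Fin n → Pauli), U * pauliOp P * Uᴴ = sgn s • pauliOp Q

/-- `U` and `V` are equal as channels: conjugation by them is the same map on density matrices. -/
def SameChannel {n : ℕ} (U V : Op n) : Prop :=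
  ∀ ρ : Op n, ρ.PosSemidef → ρ.trace = 1 → U * ρ * Uᴴ = V * ρ * Vᴴ

/-! ### Pure states and measurement -/

/-- Unit vectors of an `n`-qubit register. -/
def PureState (n : ℕ) : Type := {φ : Bits n → ℂ // ∑ x, ‖φ x‖ ^ 2 = 1}

theorem sum_normSq_eq {n : ℕ} (φ : Bits n → ℂ) :
    ((∑ x, ‖φ x‖ ^ 2 : ℝ) : ℂ) = star φ ⬝ᵥ φ := by
  simp [dotProduct, Complex.conj_mul']

theorem sum_normSq_mulVec {n : ℕ} (U : Op n) (hU : Uᴴ * U = 1) (φ : Bits n → ℂ) :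
    ∑ x, ‖(U *ᵥ φ) x‖ ^ 2 = ∑ x, ‖φ x‖ ^ 2 := by
  have h : star (U *ᵥ φ) ⬝ᵥ (U *ᵥ φ) = star φ ⬝ᵥ φ := by
    rw [star_mulVec, ← dotProduct_mulVec, mulVec_mulVec, hU, one_mulVec]
  rw [← sum_normSq_eq, ← sum_normSq_eq] at h
  exact_mod_cast h

/-- The state `U|φ⟩`. -/
def PureState.apply {n : ℕ} (U : UnitaryOp n) (φ : PureState n) : PureState n :=
  ⟨(U : Op n) *ᵥ φ.1, by
    rw [sum_normSq_mulVec _ (Matrix.mem_unitaryGroup_iff'.1 U.2), φ.2]⟩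

theorem tensor_mul {n : ℕ} (A B : Fin n → Matrix (Fin 2) (Fin 2) ℂ) :
    tensor A * tensor B = tensor fun j => A j * B j := by
  ext x y
  simp only [tensor, Matrix.mul_apply, Matrix.of_apply, ← Finset.prod_mul_distrib]
  rw [Finset.prod_univ_sum, Fintype.piFinset_univ]

theorem tensor_one {n : ℕ} : tensor (fun _ : Fin n => 1) = 1 := by
  ext x y
  simp only [tensor, Matrix.of_apply, Matrix.one_apply, Finset.prod_ite_zero, funext_iff]
  simp

theorem tensor_conjTranspose {n : ℕ} (A : Fin n → Matrix (Fin 2) (Fin 2) ℂ) :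
    (tensor A)ᴴ = tensor fun j => (A j)ᴴ := by
  ext x y
  simp [tensor, Matrix.conjTranspose_apply]

theorem pauliOp_conjTranspose_mul {n : ℕ} (P : Fin n → Pauli) :
    (pauliOp P)ᴴ * pauliOp P = 1 := by
  rw [pauliOp, tensor_conjTranspose, tensor_mul, ← tensor_one]
  congr 1
  funext j
  cases P j <;> ext a b <;> fin_cases a <;> fin_cases b <;>
    simp [Pauli.mat, Matrix.mul_apply, Fin.sum_univ_two]

/-- The projector `(1 + m P) / 2` onto the `m`-eigenspace of the `±1`-valued observable `P`. -/
noncomputable def eigenProj {n : ℕ} (P : Fin n → Pauli) (m : ℤˣ) : Op n :=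
  (1 / 2 : ℂ) • (1 + sgn m • pauliOp P)

/-- Born's rule: measuring the observable `P` on `|φ⟩` gives `m` with probability `‖Π_m φ‖²`. -/
noncomputable def bornProb {n : ℕ} (P : Fin n → Pauli) (φ : PureState n) (m : ℤˣ) : ℝ :=
  ∑ x, ‖(eigenProj P m *ᵥ φ.1) x‖ ^ 2

theorem bornProb_nonneg {n : ℕ} (P : Fin n → Pauli) (φ : PureState n) (m : ℤˣ) :
    0 ≤ bornProb P φ m :=
  Finset.sum_nonneg fun _ _ => by positivity

theorem bornProb_sum {n : ℕ} (P : Fin n → Pauli) (φ : PureState n) :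
    ∑ m, bornProb P φ m = 1 := by
  have h1 := φ.2
  have h2 := sum_normSq_mulVec _ (pauliOp_conjTranspose_mul P) φ.1
  have key : ∀ x, ‖(eigenProj P 1 *ᵥ φ.1) x‖ ^ 2 + ‖(eigenProj P (-1) *ᵥ φ.1) x‖ ^ 2 =
      (‖φ.1 x‖ ^ 2 + ‖(pauliOp P *ᵥ φ.1) x‖ ^ 2) / 2 := by
    intro x
    have e1 : (eigenProj P 1 *ᵥ φ.1) x = (1 / 2 : ℂ) * (φ.1 x + (pauliOp P *ᵥ φ.1) x) := by
      simp [eigenProj, smul_mulVec, add_mulVec, sgn, mul_add]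
    have e2 : (eigenProj P (-1) *ᵥ φ.1) x = (1 / 2 : ℂ) * (φ.1 x - (pauliOp P *ᵥ φ.1) x) := by
      simp [eigenProj, smul_mulVec, add_mulVec, neg_mulVec, sgn, sub_eq_add_neg, mul_add]
    rw [e1, e2, norm_mul, norm_mul, mul_pow, mul_pow]
    have := parallelogram_law_with_norm ℝ (φ.1 x) ((pauliOp P *ᵥ φ.1) x)
    norm_num
    nlinarith
  have hu : (Finset.univ : Finset ℤˣ) = {1, -1} := rfl
  rw [hu, Finset.sum_pair (by decide)]
  simp only [bornProb]
  rw [← Finset.sum_add_distrib, Finset.sum_congr rfl fun x _ => key x, ← Finset.sum_div,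
    Finset.sum_add_distrib, h2, h1]
  norm_num

/-- The distribution of the outcome when the observable `P` is measured on `|φ⟩`. -/
noncomputable def measurePauli {n : ℕ} (P : Fin n → Pauli) (φ : PureState n) : PMF ℤˣ :=
  PMF.ofFintype (fun m => ENNReal.ofReal (bornProb P φ m)) (by
    rw [← ENNReal.ofReal_sum_of_nonneg fun m _ => bornProb_nonneg P φ m, bornProb_sum, ENNReal.ofReal_one])

/-! ### The test -/

/-- The state prepared on a qubit where `Q` acts by the Pauli `q`: for `q ∈ {X, Y, Z}` the
`σ`-eigenstate of `q`, for `q = I` the state `(|0⟩ + e^{iπ/4}|1⟩)/√2` (whatever `σ` is). -/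
noncomputable def qubitState : Pauli → ℤˣ → Fin 2 → ℂ
  | .I, _ => ![1 / (√2 : ℂ), Complex.exp (Complex.I * Real.pi / 4) / (√2 : ℂ)]
  | .X, σ => ![1 / (√2 : ℂ), sgn σ / (√2 : ℂ)]
  | .Y, σ => ![1 / (√2 : ℂ), sgn σ * Complex.I / (√2 : ℂ)]
  | .Z, σ => if σ = 1 then ![1, 0] else ![0, 1]

theorem qubitState_norm (q : Pauli) (σ : ℤˣ) : ∑ b, ‖qubitState q σ b‖ ^ 2 = 1 := by
  have hs : ‖(√2 : ℂ)‖ ^ 2 = 2 := by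
    rw [Complex.norm_real, Real.norm_eq_abs, sq_abs, Real.sq_sqrt (by norm_num)]
  have he : ‖Complex.exp (Complex.I * Real.pi / 4)‖ = 1 := by
    have : Complex.I * Real.pi / 4 = ((Real.pi / 4 : ℝ) : ℂ) * Complex.I := by
      push_cast; ring
    rw [this, Complex.norm_exp_ofReal_mul_I]
  rcases Int.units_eq_one_or σ with rfl | rfl <;> cases q <;>
    simp only [qubitState, Fin.sum_univ_two, Matrix.cons_val_zero, Matrix.cons_val_one, norm_div,
      div_pow, hs, he, norm_mul] <;> norm_num

/-- The product state `|ψ_in⟩` prepared for the Pauli string `Q` and the random signs `σ`. -/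
noncomputable def inputState {n : ℕ} (Q : Fin n → Pauli) (σ : Fin n → ℤˣ) : PureState n :=
  ⟨fun x => ∏ j, qubitState (Q j) (σ j) (x j), by
    simp only [norm_prod, ← Finset.prod_pow]
    have h := Finset.prod_univ_sum (fun _ : Fin n => (Finset.univ : Finset (Fin 2)))
      (fun j b => ‖qubitState (Q j) (σ j) b‖ ^ 2)
    rw [Fintype.piFinset_univ] at h
    rw [← h]
    exact Finset.prod_eq_one fun j _ => qubitState_norm (Q j) (σ j)⟩

/-- The sign `s` and the string `Q₁, …, Qₙ` with `U† P U = s Q₁ ⊗ ⋯ ⊗ Qₙ`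
(unique if they exist, which they do for Clifford `U`). -/
noncomputable def pullback {n : ℕ} (U : Op n) (P : Fin n → Pauli) : ℤˣ × (Fin n → Pauli) :=
  Classical.epsilon fun r => Uᴴ * pauliOp P * U = sgn r.1 • pauliOp r.2

/-- The eigenvalue of `s Q₁ ⊗ ⋯ ⊗ Qₙ` on the input state prepared for `Q` and `σ`. -/
def predicted {n : ℕ} (r : ℤˣ × (Fin n → Pauli)) (σ : Fin n → ℤˣ) : ℤˣ :=
  r.1 * ∏ j, if r.2 j = .I then 1 else σ j

/-- One run of the test: draw a uniformly random Pauli `P`, compute `U† P U = s Q₁ ⊗ ⋯ ⊗ Qₙ`,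
prepare the input state with uniformly random signs, run `V` on it once, measure `P`.
The result is the pair (predicted value `λ`, observed outcome). -/
noncomputable def test {n : ℕ} (U V : UnitaryOp n) : PMF (ℤˣ × ℤˣ) :=
  (PMF.uniformOfFintype (Fin n → Pauli)).bind fun P =>
    (PMF.uniformOfFintype (Fin n → ℤˣ)).bind fun σ =>
      (measurePauli P ((inputState (pullback (U : Op n) P).2 σ).apply V)).map fun m =>
        (predicted (pullback (U : Op n) P) σ, m)

instance : MeasurableSingletonClass ℤˣ where
  measurableSet_singleton s :=
    ⟨{(s : ℤ)}, measurableSet_singleton _, by ext t; simp [Units.ext_iff]⟩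

/-- The joint distribution of `k` independent runs of the test. -/
noncomputable def repeatedTest {n : ℕ} (U V : UnitaryOp n) (k : ℕ) :
    Measure (Fin k → ℤˣ × ℤˣ) :=
  Measure.pi fun _ => (test U V).toMeasure

/-- The event that a difference is detected: some run has an outcome other than predicted. -/
def detected (k : ℕ) : Set (Fin k → ℤˣ × ℤˣ) := {ω | ∃ i, (ω i).2 ≠ (ω i).1}

end CliffordTest

open CliffordTest

namespace CliffordTest

/-! ### Tensor products -/

/-! Let `U` and `V` pull `P` back to `s Q` and `s' Q'`. Measuring `P` on `V ψ` has mean `s' ⟨ψ, Q'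
ψ⟩`. As `ψ` is a product state with independent signs, this mean times the predicted value, averaged
over the signs, factorises as `s s' ∏ⱼ overlap (Q j) (Q' j)` (`sum_expectation_inputState`).

The factor is `1` for equal letters. For different letters it is `0` if `Q j ≠ I`, and `√2/2` or `0`
if `Q j = I`, because the state prepared there has Bloch vector `(1, 1, 0)/√2`. So `Q ≠ Q'` leaves a
correlation of at most `3/4`, whatever `n` is, and `Q = Q'` with `s ≠ s'` gives `-1`. In both cases
the wrong outcome has average probability at least `(1 - 3/4)/2 = 1/8` (`le_sum_bornProb`).

It remains to see that many `P` are pulled back differently. The two pullbacks agree exactly when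
`P` commutes with `W = V U†`. If all Paulis did, `W` would commute with every operator, as the
Paulis span, and the channels would be equal. So some Pauli `R` fails to commute, and multiplication
by `R` injects the commuting Paulis into the others: at least half of all `P` expose the difference
(`exists_finset_pullback_ne`). Hence `c = 1/2 · 1/8 = 1/16`, and independence together with `15/16 ≤
exp (-1/16)` gives `C = 16`. -/

theorem tensor_smul {n : ℕ} (c : Fin n → ℂ) (A : Fin n → Matrix (Fin 2) (Fin 2) ℂ) :
    tensor (fun j => c j • A j) = (∏ j, c j) • tensor A := by
  ext x y
  simp [tensor, Finset.prod_mul_distrib]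

theorem trace_tensor {n : ℕ} (A : Fin n → Matrix (Fin 2) (Fin 2) ℂ) :
    (tensor A).trace = ∏ j, (A j).trace := by
  simp only [tensor, Matrix.trace, Matrix.diag_apply, Matrix.of_apply]
  rw [Finset.prod_univ_sum, Fintype.piFinset_univ]

theorem tensor_mulVec {n : ℕ} (A : Fin n → Matrix (Fin 2) (Fin 2) ℂ) (φ : Fin n → Fin 2 → ℂ) :
    tensor A *ᵥ (fun x => ∏ j, φ j (x j)) = fun x => ∏ j, (A j *ᵥ φ j) (x j) := by
  ext x
  simp only [tensor, Matrix.mulVec, dotProduct, Matrix.of_apply, ← Finset.prod_mul_distrib]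
  rw [Finset.prod_univ_sum, Fintype.piFinset_univ]

theorem dotProduct_prod {n : ℕ} (φ χ : Fin n → Fin 2 → ℂ) :
    (fun x : Bits n => ∏ j, φ j (x j)) ⬝ᵥ (fun x => ∏ j, χ j (x j)) = ∏ j, φ j ⬝ᵥ χ j := by
  simp only [dotProduct, ← Finset.prod_mul_distrib]
  rw [Finset.prod_univ_sum, Fintype.piFinset_univ]

/-! ### Pauli matrices -/

theorem Pauli.mat_conjTranspose (p : Pauli) : p.matᴴ = p.mat := by
  cases p <;> ext a b <;> fin_cases a <;> fin_cases b <;> simp [Pauli.mat]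

theorem Pauli.mat_mul_self (p : Pauli) : p.mat * p.mat = 1 := by
  cases p <;> ext a b <;> fin_cases a <;> fin_cases b <;>
    simp [Pauli.mat, Matrix.mul_apply, Fin.sum_univ_two]

theorem Pauli.trace_mat_mul {p q : Pauli} (h : p ≠ q) : (p.mat * q.mat).trace = 0 := by
  cases p <;> cases q <;> first
    | exact absurd rfl h
    | simp [Pauli.mat, Matrix.trace, Fin.sum_univ_two]

/-- The product of one-qubit Paulis up to phase. -/
def Pauli.mul : Pauli → Pauli → Pauli
  | .I, q => q
  | p, .I => p
  | .X, .X => .I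
  | .X, .Y => .Z
  | .X, .Z => .Y
  | .Y, .X => .Z
  | .Y, .Y => .I
  | .Y, .Z => .X
  | .Z, .X => .Y
  | .Z, .Y => .X
  | .Z, .Z => .I

theorem Pauli.mul_left_injective (p : Pauli) : Function.Injective p.mul := by
  intro q r h
  revert p q r
  decide

theorem Pauli.exists_mat_mul (p q : Pauli) :
    ∃ c : ℂ, p.mat * q.mat = c • (p.mul q).mat := by
  cases p <;> cases q <;> first
    | refine ⟨1, ?_⟩
      ext a b; fin_cases a <;> fin_cases b <;>
        simp [Pauli.mat, Pauli.mul, Matrix.mul_apply, Fin.sum_univ_two]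
      done
    | refine ⟨Complex.I, ?_⟩
      ext a b; fin_cases a <;> fin_cases b <;>
        simp [Pauli.mat, Pauli.mul, Matrix.mul_apply, Fin.sum_univ_two]
      done
    | refine ⟨-Complex.I, ?_⟩
      ext a b; fin_cases a <;> fin_cases b <;>
        simp [Pauli.mat, Pauli.mul, Matrix.mul_apply, Fin.sum_univ_two]

theorem exists_pauliOp_mul {n : ℕ} (P Q : Fin n → Pauli) :
    ∃ c : ℂ, pauliOp P * pauliOp Q = c • pauliOp fun j => (P j).mul (Q j) := by
  choose c h using fun j => Pauli.exists_mat_mul (P j) (Q j)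
  refine ⟨∏ j, c j, ?_⟩
  simp only [pauliOp, tensor_mul, h, tensor_smul]

theorem pauliOp_conjTranspose {n : ℕ} (P : Fin n → Pauli) : (pauliOp P)ᴴ = pauliOp P := by
  simp [pauliOp, tensor_conjTranspose, Pauli.mat_conjTranspose]

theorem pauliOp_mul_self {n : ℕ} (P : Fin n → Pauli) : pauliOp P * pauliOp P = 1 := by
  simp [pauliOp, tensor_mul, Pauli.mat_mul_self, tensor_one]

/-- Distinct Pauli strings are orthogonal for the trace form, since one tensor factor of their
product is traceless, whereas `P² = 1` has nonzero trace. -/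
theorem pauliOp_ne_smul {n : ℕ} {P Q : Fin n → Pauli} (h : P ≠ Q) (c : ℂ) :
    pauliOp P ≠ c • pauliOp Q := by
  intro e
  obtain ⟨j, hj⟩ := Function.ne_iff.1 h
  have h0 : (pauliOp Q * pauliOp P).trace = 0 := by
    rw [pauliOp, pauliOp, tensor_mul, trace_tensor]
    exact Finset.prod_eq_zero (Finset.mem_univ j) (Pauli.trace_mat_mul hj.symm)
  have h1 : (pauliOp P * pauliOp P).trace = 0 := by
    nth_rw 1 [e]
    rw [smul_mul_assoc, Matrix.trace_smul, h0, smul_zero]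
  rw [pauliOp_mul_self, Matrix.trace_one] at h1
  simp at h1

theorem exists_eq_sum_pauli (A : Matrix (Fin 2) (Fin 2) ℂ) :
    ∃ c : Pauli → ℂ, A = ∑ p, c p • p.mat := by
  -- The coefficient of `p` is `tr (p A) / 2`.
  refine ⟨fun
    | .I => (A 0 0 + A 1 1) / 2
    | .X => (A 0 1 + A 1 0) / 2
    | .Y => (A 0 1 - A 1 0) / 2 * Complex.I
    | .Z => (A 0 0 - A 1 1) / 2, ?_⟩
  have hu : (Finset.univ : Finset Pauli) = {.I, .X, .Y, .Z} := rfl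
  rw [hu]
  have hI : ∀ z : ℂ, z * Complex.I * Complex.I = -z := fun z => by
    rw [mul_assoc, Complex.I_mul_I]; ring
  ext a b
  fin_cases a <;> fin_cases b <;> simp [Pauli.mat, hI] <;> ring

theorem exists_tensor_eq_sum_pauliOp {n : ℕ} (A : Fin n → Matrix (Fin 2) (Fin 2) ℂ) :
    ∃ c : (Fin n → Pauli) → ℂ, tensor A = ∑ P, c P • pauliOp P := by
  choose c hc using fun j => exists_eq_sum_pauli (A j)
  refine ⟨fun P => ∏ j, c j (P j), ?_⟩
  ext x y
  simp only [tensor, pauliOp, Matrix.of_apply, Matrix.sum_apply, Matrix.smul_apply, smul_eq_mul,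
    ← Finset.prod_mul_distrib]
  rw [Finset.prod_congr rfl fun j _ => congrFun (congrFun (hc j) (x j)) (y j)]
  simp only [Matrix.sum_apply, Matrix.smul_apply, smul_eq_mul]
  rw [Finset.prod_univ_sum, Fintype.piFinset_univ]

theorem single_eq_tensor {n : ℕ} (x y : Bits n) :
    Matrix.single x y (1 : ℂ) = tensor fun j => Matrix.single (x j) (y j) 1 := by
  ext a b
  simp only [tensor, Matrix.of_apply, Matrix.single_apply, Finset.prod_ite_zero, funext_iff]
  simp [forall_and]

/-- An operator that commutes with all Paulis commutes with all operators. -/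
theorem commute_of_commute_pauliOp {n : ℕ} {W : Op n} (h : ∀ P, Commute W (pauliOp P)) (M : Op n) :
    Commute W M := by
  -- Matrix units are tensor products of one-qubit matrix units, hence combinations of Paulis.
  rw [Matrix.matrix_eq_sum_single M]
  refine Commute.sum_right _ _ _ fun x _ => Commute.sum_right _ _ _ fun y _ => ?_
  obtain ⟨c, hc⟩ := exists_tensor_eq_sum_pauliOp fun j => Matrix.single (x j) (y j) (1 : ℂ)
  have : Matrix.single x y (M x y) = M x y • Matrix.single x y (1 : ℂ) := by simp
  rw [this, single_eq_tensor, hc]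
  exact (Commute.sum_right _ _ _ fun P _ => (h P).smul_right _).smul_right _

/-! ### Clifford circuits -/

theorem isClifford_one {n : ℕ} : IsClifford (1 : Op n) :=
  ⟨one_mem _, fun P => ⟨1, P, by simp [sgn]⟩⟩

theorem IsClifford.mul {n : ℕ} {U V : Op n} (hU : IsClifford U) (hV : IsClifford V) :
    IsClifford (U * V) := by
  refine ⟨mul_mem hU.1 hV.1, fun P => ?_⟩
  obtain ⟨s, Q, h⟩ := hV.2 P
  obtain ⟨t, R, h'⟩ := hU.2 Q
  refine ⟨s * t, R, ?_⟩
  calc U * V * pauliOp P * (U * V)ᴴ = U * (V * pauliOp P * Vᴴ) * Uᴴ := by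
        simp only [Matrix.conjTranspose_mul, Matrix.mul_assoc]
    _ = sgn (s * t) • pauliOp R := by
        rw [h, Matrix.mul_smul, Matrix.smul_mul, h', smul_smul]
        simp [sgn]

/-- Conjugation by a tensor product acts factor by factor, so only the one-qubit action matters; the
signs multiply. -/
theorem isClifford_onQubit {n : ℕ} (j : Fin n) {A : Matrix (Fin 2) (Fin 2) ℂ} (hA : A * Aᴴ = 1)
    (h : ∀ p : Pauli, ∃ (s : ℤˣ) (q : Pauli), A * p.mat * Aᴴ = sgn s • q.mat) :
    IsClifford (onQubit j A) := by
  constructor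
  · rw [Matrix.mem_unitaryGroup_iff, Matrix.star_eq_conjTranspose, onQubit, tensor_conjTranspose,
      tensor_mul, ← tensor_one]
    congr 1
    funext i
    rcases eq_or_ne i j with rfl | hi <;> simp [*]
  · intro P
    have : ∀ i, ∃ (s : ℤˣ) (q : Pauli),
        (Function.update (fun _ => 1) j A : Fin n → Matrix (Fin 2) (Fin 2) ℂ) i * (P i).mat *
          ((Function.update (fun _ => 1) j A : Fin n → Matrix (Fin 2) (Fin 2) ℂ) i)ᴴ =
            sgn s • q.mat := by
      intro i
      rcases eq_or_ne i j with rfl | hi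
      · simpa using h (P i)
      · exact ⟨1, P i, by simp [hi, sgn]⟩
    choose s Q hQ using this
    refine ⟨∏ i, s i, Q, ?_⟩
    rw [onQubit, tensor_conjTranspose, pauliOp, tensor_mul, tensor_mul]
    simp only [hQ]
    rw [tensor_smul, pauliOp]
    simp [sgn, Units.coe_prod]

theorem isClifford_pauli {n : ℕ} (p : Pauli) (j : Fin n) : IsClifford (Gate.pauli p j).mat := by
  refine isClifford_onQubit j (by rw [Pauli.mat_conjTranspose, Pauli.mat_mul_self]) fun q => ?_
  -- Two Paulis commute or anticommute, so conjugation changes at most the sign.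
  have : ∃ s : ℤˣ, p.mat * q.mat * p.matᴴ = sgn s • q.mat := by
    cases p <;> cases q <;> first
      | refine ⟨1, ?_⟩
        ext a b; fin_cases a <;> fin_cases b <;>
          simp [Pauli.mat, Matrix.mul_apply, Fin.sum_univ_two, sgn]
        done
      | refine ⟨-1, ?_⟩
        ext a b; fin_cases a <;> fin_cases b <;>
          simp [Pauli.mat, Matrix.mul_apply, Fin.sum_univ_two, sgn]
  exact this.imp fun s hs => ⟨q, hs⟩

theorem ofReal_sqrt_two_mul_self : (√2 : ℂ) * (√2 : ℂ) = 2 := by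
  rw [← Complex.ofReal_mul, Real.mul_self_sqrt (by norm_num)]
  norm_num

theorem inv_ofReal_sqrt_two_mul_self : (√2 : ℂ)⁻¹ * (√2 : ℂ)⁻¹ = 1 / 2 := by
  rw [← mul_inv, ofReal_sqrt_two_mul_self]
  norm_num

theorem isClifford_hadamard {n : ℕ} (j : Fin n) : IsClifford (Gate.hadamard j).mat := by
  have h2 := inv_ofReal_sqrt_two_mul_self
  have hI : ∀ z : ℂ, z * Complex.I * z = z * z * Complex.I := fun z => by ring
  refine isClifford_onQubit j ?_ fun p => ?_
  · ext a b
    fin_cases a <;> fin_cases b <;>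
      simp [Matrix.mul_apply, Fin.sum_univ_two, neg_div, h2] <;> norm_num
  · cases p
    -- Hadamard exchanges `X` and `Z` and negates `Y`.
    on_goal 1 => refine ⟨1, .I, ?_⟩
    on_goal 2 => refine ⟨1, .Z, ?_⟩
    on_goal 3 => refine ⟨-1, .Y, ?_⟩
    on_goal 4 => refine ⟨1, .X, ?_⟩
    all_goals
      ext a b
      fin_cases a <;> fin_cases b <;>
        simp [Pauli.mat, Matrix.mul_apply, Fin.sum_univ_two, sgn, neg_div, h2, hI] <;> ring

theorem isClifford_phase {n : ℕ} (j : Fin n) : IsClifford (Gate.phase j).mat := by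
  refine isClifford_onQubit j ?_ fun p => ?_
  · ext a b
    fin_cases a <;> fin_cases b <;> simp [Matrix.mul_apply, Fin.sum_univ_two]
  · cases p
    -- The phase gate is a quarter turn about the `Z` axis: `X ↦ Y ↦ -X`.
    on_goal 1 => refine ⟨1, .I, ?_⟩
    on_goal 2 => refine ⟨1, .Y, ?_⟩
    on_goal 3 => refine ⟨-1, .X, ?_⟩
    on_goal 4 => refine ⟨1, .Z, ?_⟩
    all_goals
      ext a b
      fin_cases a <;> fin_cases b <;>
        simp [Pauli.mat, Matrix.mul_apply, Fin.sum_univ_two, sgn]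

/-- The action of a CNOT gate on basis labels. -/
def cnotPerm {n : ℕ} (c t : Fin n) (x : Bits n) : Bits n := Function.update x t (x t + x c)

theorem cnotPerm_cnotPerm {n : ℕ} {c t : Fin n} (h : c ≠ t) (x : Bits n) :
    cnotPerm c t (cnotPerm c t x) = x := by
  have h2 : ∀ a b : Fin 2, a + b + b = a := by decide
  simp [cnotPerm, h, h2]

theorem cnot_mat_apply {n : ℕ} {c t : Fin n} (h : c ≠ t) (x y : Bits n) :
    (Gate.cnot c t h).mat x y = if cnotPerm c t x = y then 1 else 0 := by
  have : x = cnotPerm c t y ↔ cnotPerm c t x = y :=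
    ⟨fun e => by rw [e, cnotPerm_cnotPerm h], fun e => by rw [← e, cnotPerm_cnotPerm h]⟩
  simp only [Gate.mat, Matrix.of_apply, ← this]
  rfl

/-- CNOT is the permutation matrix of an involution, so conjugating by it relabels rows and columns.
-/
theorem cnot_conj_apply {n : ℕ} {c t : Fin n} (h : c ≠ t) (M : Op n) (x y : Bits n) :
    ((Gate.cnot c t h).mat * M * (Gate.cnot c t h).matᴴ) x y =
      M (cnotPerm c t x) (cnotPerm c t y) := by
  simp [Matrix.mul_apply, Matrix.conjTranspose_apply, cnot_mat_apply, apply_ite]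

/-- The two-qubit conjugation table, read entrywise: `a, a'` index the control and `b, b'` the
target. The only minus signs come from `X ⊗ Z ↔ -Y ⊗ Y`. -/
theorem Pauli.exists_cnot_conj (p q : Pauli) : ∃ (s : ℤˣ) (p' q' : Pauli), ∀ a a' b b' : Fin 2,
    p.mat a a' * q.mat (b + a) (b' + a') = sgn s * (p'.mat a a' * q'.mat b b') := by
  have h : ∀ a : Fin 2, a + 1 = 1 - a := by decide
  cases p <;> cases q
  on_goal 1 => refine ⟨1, .I, .I, ?_⟩
  on_goal 2 => refine ⟨1, .I, .X, ?_⟩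
  on_goal 3 => refine ⟨1, .Z, .Y, ?_⟩
  on_goal 4 => refine ⟨1, .Z, .Z, ?_⟩
  on_goal 5 => refine ⟨1, .X, .X, ?_⟩
  on_goal 6 => refine ⟨1, .X, .I, ?_⟩
  on_goal 7 => refine ⟨1, .Y, .Z, ?_⟩
  on_goal 8 => refine ⟨-1, .Y, .Y, ?_⟩
  on_goal 9 => refine ⟨1, .Y, .X, ?_⟩
  on_goal 10 => refine ⟨1, .Y, .I, ?_⟩
  on_goal 11 => refine ⟨-1, .X, .Z, ?_⟩
  on_goal 12 => refine ⟨1, .X, .Y, ?_⟩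
  on_goal 13 => refine ⟨1, .Z, .I, ?_⟩
  on_goal 14 => refine ⟨1, .Z, .X, ?_⟩
  on_goal 15 => refine ⟨1, .I, .Y, ?_⟩
  on_goal 16 => refine ⟨1, .I, .Z, ?_⟩
  all_goals simp [Fin.forall_fin_two, Pauli.mat, sgn, h, Matrix.one_apply]

theorem isClifford_cnot {n : ℕ} {c t : Fin n} (h : c ≠ t) : IsClifford (Gate.cnot c t h).mat := by
  constructor
  · rw [Matrix.mem_unitaryGroup_iff, Matrix.star_eq_conjTranspose]
    ext x y
    have := cnot_conj_apply h 1 x y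
    rw [Matrix.mul_one] at this
    rw [this, Matrix.one_apply, Matrix.one_apply]
    simp only [(Function.LeftInverse.injective (cnotPerm_cnotPerm h)).eq_iff]
  · intro P
    obtain ⟨s, p', q', hs⟩ := Pauli.exists_cnot_conj (P c) (P t)
    refine ⟨s, Function.update (Function.update P c p') t q', ?_⟩
    ext x y
    rw [cnot_conj_apply, Matrix.smul_apply, smul_eq_mul]
    simp only [pauliOp, tensor, Matrix.of_apply]
    have hc : c ∈ Finset.univ.erase t := Finset.mem_erase.2 ⟨h, Finset.mem_univ c⟩
    -- Target and control factors are split off on both sides; the remaining qubits are untouched.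
    rw [← Finset.mul_prod_erase _ _ (Finset.mem_univ t), ← Finset.mul_prod_erase _ _ hc,
      ← Finset.mul_prod_erase _ _ (Finset.mem_univ t), ← Finset.mul_prod_erase _ _ hc]
    have hr : ∀ i ∈ (Finset.univ.erase t).erase c,
        (P i).mat (cnotPerm c t x i) (cnotPerm c t y i) =
          (Function.update (Function.update P c p') t q' i).mat (x i) (y i) := by
      intro i hi
      simp only [Finset.mem_erase, Finset.mem_univ, and_true] at hi
      simp [cnotPerm, hi.1, hi.2]
    rw [Finset.prod_congr rfl hr]
    have := hs (x c) (y c) (x t) (y t)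
    simp only [cnotPerm, Function.update_self, Function.update_of_ne h]
    linear_combination (∏ i ∈ (Finset.univ.erase t).erase c,
      (Function.update (Function.update P c p') t q' i).mat (x i) (y i)) * this

theorem Gate.isClifford {n : ℕ} : ∀ g : Gate n, IsClifford g.mat
  | .pauli p j => isClifford_pauli p j
  | .hadamard j => isClifford_hadamard j
  | .phase j => isClifford_phase j
  | .cnot _ _ h => isClifford_cnot h

theorem isClifford_circuitMat {n : ℕ} (gates : List (Gate n)) : IsClifford (circuitMat gates) := by
  suffices ∀ M : Op n, IsClifford M → IsClifford (gates.foldl (fun M g => g.mat * M) M) from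
    this 1 isClifford_one
  induction gates with
  | nil => exact fun M hM => hM
  | cons g gs ih => exact fun M hM => ih _ (g.isClifford.mul hM)

/-! ### Pulling back Paulis -/

theorem sgn_mul_self (s : ℤˣ) : sgn s * sgn s = 1 := by
  rcases Int.units_eq_one_or s with rfl | rfl <;> simp [sgn]

theorem conjTranspose_mul_self {n : ℕ} (U : UnitaryOp n) : (U : Op n)ᴴ * (U : Op n) = 1 :=
  Matrix.mem_unitaryGroup_iff'.1 U.2

theorem mul_conjTranspose_self {n : ℕ} (U : UnitaryOp n) : (U : Op n) * (U : Op n)ᴴ = 1 :=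
  Matrix.mem_unitaryGroup_iff.1 U.2

theorem conjTranspose_conj {n : ℕ} (U : UnitaryOp n) (M : Op n) :
    (U : Op n)ᴴ * ((U : Op n) * M * (U : Op n)ᴴ) * (U : Op n) = M := by
  have h := conjTranspose_mul_self U
  calc (U : Op n)ᴴ * ((U : Op n) * M * (U : Op n)ᴴ) * (U : Op n)
      = ((U : Op n)ᴴ * U) * M * ((U : Op n)ᴴ * U) := by simp only [Matrix.mul_assoc]
    _ = M := by rw [h, Matrix.one_mul, Matrix.mul_one]

/-- `IsClifford` concerns `U P U†`, while the test needs `U† P U`. Conjugation induces a map `F` on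
the finite set of Pauli strings; it is injective because distinct Paulis are not proportional, hence
surjective. -/
theorem pullback_spec {n : ℕ} {U : UnitaryOp n} (hU : IsClifford (U : Op n)) (P : Fin n → Pauli) :
    (U : Op n)ᴴ * pauliOp P * (U : Op n) =
      sgn (pullback (U : Op n) P).1 • pauliOp (pullback (U : Op n) P).2 := by
  choose s F hF using hU.2
  have hF' : ∀ R, pauliOp R = sgn (s R) • ((U : Op n)ᴴ * pauliOp (F R) * (U : Op n)) := fun R => by
    rw [← conjTranspose_conj U (pauliOp R), hF, Matrix.mul_smul, Matrix.smul_mul]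
  have hinj : Function.Injective F := by
    intro R R' e
    by_contra hne
    refine pauliOp_ne_smul hne (sgn (s R) * sgn (s R')) ?_
    rw [hF' R, hF' R', e, smul_smul, mul_assoc (sgn _), sgn_mul_self, mul_one]
  obtain ⟨R, rfl⟩ := Finite.surjective_of_injective hinj P
  refine Classical.epsilon_spec (p := fun r : ℤˣ × (Fin n → Pauli) =>
    (U : Op n)ᴴ * pauliOp (F R) * (U : Op n) = sgn r.1 • pauliOp r.2) ⟨(s R, R), ?_⟩
  rw [hF' R, smul_smul, sgn_mul_self, one_smul]

/-! ### Expectation values -/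

theorem eigenProj_conjTranspose {n : ℕ} (P : Fin n → Pauli) (m : ℤˣ) :
    (eigenProj P m)ᴴ = eigenProj P m := by
  simp [eigenProj, pauliOp_conjTranspose, sgn]

theorem eigenProj_mul_self {n : ℕ} (P : Fin n → Pauli) (m : ℤˣ) :
    eigenProj P m * eigenProj P m = eigenProj P m := by
  have h := sgn_mul_self m
  simp only [eigenProj, Matrix.smul_mul, Matrix.mul_smul, mul_add, add_mul, Matrix.one_mul,
    Matrix.mul_one, pauliOp_mul_self]
  match_scalars
  · linear_combination (1 / 4) * h
  · ring

/-- The probability of the outcome `m` in terms of the expectation value of the observable. -/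
theorem bornProb_eq {n : ℕ} (P : Fin n → Pauli) (φ : PureState n) (m : ℤˣ) :
    bornProb P φ m = (1 + (sgn m * (star φ.1 ⬝ᵥ pauliOp P *ᵥ φ.1)).re) / 2 := by
  have h : ((bornProb P φ m : ℝ) : ℂ) = (1 + sgn m * (star φ.1 ⬝ᵥ pauliOp P *ᵥ φ.1)) / 2 := by
    have hφ : star φ.1 ⬝ᵥ φ.1 = 1 := by rw [← sum_normSq_eq, φ.2, Complex.ofReal_one]
    rw [bornProb, sum_normSq_eq, star_mulVec, ← dotProduct_mulVec, mulVec_mulVec,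
      eigenProj_conjTranspose, eigenProj_mul_self, eigenProj, smul_mulVec, add_mulVec, smul_mulVec,
      one_mulVec, dotProduct_smul, dotProduct_add, dotProduct_smul, hφ, smul_eq_mul, smul_eq_mul]
    ring
  have h2 := congrArg Complex.re h
  rw [Complex.ofReal_re] at h2
  rw [h2]
  simp

theorem expectation_apply {n : ℕ} (V : UnitaryOp n) (M : Op n) (ψ : PureState n) :
    star (ψ.apply V).1 ⬝ᵥ M *ᵥ (ψ.apply V).1 =
      star ψ.1 ⬝ᵥ ((V : Op n)ᴴ * M * (V : Op n)) *ᵥ ψ.1 := by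
  simp only [PureState.apply]
  rw [star_mulVec, ← dotProduct_mulVec, mulVec_mulVec, mulVec_mulVec, Matrix.mul_assoc]

/-- An expectation value is the trace of `M` against the channel output on the density matrix `ψ
ψ†`. -/
theorem SameChannel.expectation_eq {n : ℕ} {U V : UnitaryOp n}
    (h : SameChannel (U : Op n) (V : Op n)) (M : Op n) (ψ : PureState n) :
    star (ψ.apply V).1 ⬝ᵥ M *ᵥ (ψ.apply V).1 = star (ψ.apply U).1 ⬝ᵥ M *ᵥ (ψ.apply U).1 := by
  have key : ∀ W : UnitaryOp n, star (ψ.apply W).1 ⬝ᵥ M *ᵥ (ψ.apply W).1 =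
      (M * ((W : Op n) * vecMulVec ψ.1 (star ψ.1) * (W : Op n)ᴴ)).trace := by
    intro W
    rw [mul_vecMulVec, vecMulVec_mul, ← star_mulVec, mul_vecMulVec, trace_vecMulVec,
      dotProduct_comm]
    rfl
  rw [key, key, h _ (posSemidef_vecMulVec_self_star _)]
  rw [trace_vecMulVec, dotProduct_comm, ← sum_normSq_eq, ψ.2, Complex.ofReal_one]

theorem pauli_mulVec_qubitState (q : Pauli) (σ : ℤˣ) :
    q.mat *ᵥ qubitState q σ = sgn (if q = .I then 1 else σ) • qubitState q σ := by
  rcases Int.units_eq_one_or σ with rfl | rfl <;> cases q <;> ext b <;> fin_cases b <;>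
    simp [Pauli.mat, qubitState, sgn, Matrix.mulVec, dotProduct, Fin.sum_univ_two, div_eq_mul_inv,
      Matrix.one_apply, ← mul_assoc]

theorem pauliOp_mulVec_inputState {n : ℕ} (Q : Fin n → Pauli) (σ : Fin n → ℤˣ) :
    pauliOp Q *ᵥ (inputState Q σ).1 =
      sgn (∏ j, if Q j = .I then 1 else σ j) • (inputState Q σ).1 := by
  simp only [pauliOp, inputState, tensor_mulVec, pauli_mulVec_qubitState]
  ext x
  simp [Finset.prod_mul_distrib, sgn, Units.coe_prod]

theorem pullback_mulVec_inputState {n : ℕ} {U : UnitaryOp n} (hU : IsClifford (U : Op n))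
    (P : Fin n → Pauli) (σ : Fin n → ℤˣ) :
    ((U : Op n)ᴴ * pauliOp P * (U : Op n)) *ᵥ (inputState (pullback (U : Op n) P).2 σ).1 =
      sgn (predicted (pullback (U : Op n) P) σ) • (inputState (pullback (U : Op n) P).2 σ).1 := by
  rw [pullback_spec hU, smul_mulVec, pauliOp_mulVec_inputState, smul_smul]
  simp [predicted, sgn]

theorem star_dotProduct_self {n : ℕ} (ψ : PureState n) : star ψ.1 ⬝ᵥ ψ.1 = 1 := by
  rw [← sum_normSq_eq, ψ.2, Complex.ofReal_one]

/-- For equal channels the predicted outcome is certain. -/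
theorem SameChannel.bornProb_eq_one {n : ℕ} {U V : UnitaryOp n} (hU : IsClifford (U : Op n))
    (h : SameChannel (U : Op n) (V : Op n)) (P : Fin n → Pauli) (σ : Fin n → ℤˣ) :
    bornProb P ((inputState (pullback (U : Op n) P).2 σ).apply V)
      (predicted (pullback (U : Op n) P) σ) = 1 := by
  rw [bornProb_eq, h.expectation_eq, expectation_apply, pullback_mulVec_inputState hU,
    dotProduct_smul, star_dotProduct_self, smul_eq_mul, mul_one, sgn_mul_self]
  norm_num

/-- The expectation value of `q'` in the state prepared for `q`, with the sign of `q` on that state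
taken out, averaged over the random sign. -/
noncomputable def overlap (q q' : Pauli) : ℂ :=
  (1 / 2) * ∑ σ : ℤˣ, sgn (if q = .I then 1 else σ) *
    (star (qubitState q σ) ⬝ᵥ q'.mat *ᵥ qubitState q σ)

theorem overlap_self (q : Pauli) : overlap q q = 1 := by
  have h : ∀ σ, star (qubitState q σ) ⬝ᵥ qubitState q σ = 1 := fun σ => by
    have := qubitState_norm q σ
    rw [← Complex.ofReal_inj] at this
    simpa [dotProduct, Complex.conj_mul'] using this
  simp only [overlap, pauli_mulVec_qubitState, dotProduct_smul, h, smul_eq_mul, mul_one,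
    sgn_mul_self]
  simp

theorem exp_I_mul_pi_div_four :
    Complex.exp (Complex.I * Real.pi / 4) = (√2 : ℂ) / 2 + (√2 : ℂ) / 2 * Complex.I := by
  have : Complex.I * Real.pi / 4 = ((Real.pi / 4 : ℝ) : ℂ) * Complex.I := by
    push_cast; ring
  rw [this, Complex.exp_mul_I, ← Complex.ofReal_cos, ← Complex.ofReal_sin, Real.cos_pi_div_four,
    Real.sin_pi_div_four]
  push_cast
  rfl

/-- For `q' = I` the two random signs cancel. Otherwise `q` and `q'` anticommute, so `q'` has mean
zero in each eigenstate of `q`. -/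
theorem overlap_eq_zero {q q' : Pauli} (hq : q ≠ .I) (h : q ≠ q') : overlap q q' = 0 := by
  have hu : (Finset.univ : Finset ℤˣ) = {1, -1} := rfl
  cases q <;> cases q' <;> first
    | exact absurd rfl h
    | exact absurd rfl hq
    | simp [overlap, hu, qubitState, Pauli.mat, sgn, Matrix.mulVec, dotProduct, Fin.sum_univ_two]
      done
    | simp [overlap, hu, qubitState, Pauli.mat, sgn, Matrix.mulVec, dotProduct, Fin.sum_univ_two]
      ring

theorem overlap_I_X : overlap .I .X = (√2 : ℂ) / 2 := by
  have hu : (Finset.univ : Finset ℤˣ) = {1, -1} := rfl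
  have h2 := inv_ofReal_sqrt_two_mul_self
  simp [overlap, hu, qubitState, Pauli.mat, sgn, Matrix.mulVec, dotProduct, Fin.sum_univ_two,
    exp_I_mul_pi_div_four, Complex.conj_ofNat]
  linear_combination (√2 : ℂ) * h2

theorem overlap_I_Y : overlap .I .Y = (√2 : ℂ) / 2 := by
  have hu : (Finset.univ : Finset ℤˣ) = {1, -1} := rfl
  have h2 := inv_ofReal_sqrt_two_mul_self
  simp [overlap, hu, qubitState, Pauli.mat, sgn, Matrix.mulVec, dotProduct, Fin.sum_univ_two,
    exp_I_mul_pi_div_four, Complex.conj_ofNat]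
  linear_combination (√2 : ℂ) * h2 - (√2 : ℂ) * (√2 : ℂ)⁻¹ * (√2 : ℂ)⁻¹ * Complex.I_sq

theorem overlap_I_Z : overlap .I .Z = 0 := by
  have hu : (Finset.univ : Finset ℤˣ) = {1, -1} := rfl
  have h2 := ofReal_sqrt_two_mul_self
  simp [overlap, hu, qubitState, Pauli.mat, sgn, Matrix.mulVec, dotProduct, Fin.sum_univ_two,
    exp_I_mul_pi_div_four, Complex.conj_ofNat]
  linear_combination -(√2 : ℂ)⁻¹ * (√2 : ℂ)⁻¹ * h2 +
    (√2 : ℂ) * (√2 : ℂ) * (√2 : ℂ)⁻¹ * (√2 : ℂ)⁻¹ / 2 * Complex.I_sq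

/-- `3/4` is a rational bound for `√2/2`. That it lies below `1` also for `q = I` is the purpose of
the phase `e^{iπ/4}`: preparing `|0⟩` there would not tell `I` from `Z`. -/
theorem norm_overlap_le {q q' : Pauli} (h : q ≠ q') : ‖overlap q q'‖ ≤ 3 / 4 := by
  have h2 : ‖(√2 : ℂ) / 2‖ ≤ 3 / 4 := by
    rw [norm_div, Complex.norm_real, Real.norm_eq_abs, abs_of_nonneg (Real.sqrt_nonneg 2),
      Complex.norm_ofNat]
    have : √2 ≤ 3 / 2 := Real.sqrt_le_iff.2 ⟨by norm_num, by norm_num⟩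
    linarith
  by_cases hq : q = .I
  · subst hq
    cases q'
    · exact absurd rfl h
    · rwa [overlap_I_X]
    · rwa [overlap_I_Y]
    · rw [overlap_I_Z, norm_zero]; norm_num
  · rw [overlap_eq_zero hq h, norm_zero]; norm_num

theorem norm_overlap_le_one (q q' : Pauli) : ‖overlap q q'‖ ≤ 1 := by
  by_cases h : q = q'
  · rw [h, overlap_self, norm_one]
  · exact (norm_overlap_le h).trans (by norm_num)

/-- One differing position suffices, since all other factors have norm at most `1`. -/
theorem norm_prod_overlap_le {n : ℕ} {Q Q' : Fin n → Pauli} (h : Q ≠ Q') :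
    ‖∏ j, overlap (Q j) (Q' j)‖ ≤ 3 / 4 := by
  obtain ⟨j, hj⟩ := Function.ne_iff.1 h
  rw [← Finset.mul_prod_erase _ _ (Finset.mem_univ j), norm_mul, norm_prod]
  have h1 := norm_overlap_le hj
  have h2 : ∏ i ∈ Finset.univ.erase j, ‖overlap (Q i) (Q' i)‖ ≤ 1 :=
    Finset.prod_le_one (fun _ _ => norm_nonneg _) fun i _ => norm_overlap_le_one _ _
  have h3 : 0 ≤ ∏ i ∈ Finset.univ.erase j, ‖overlap (Q i) (Q' i)‖ :=
    Finset.prod_nonneg fun _ _ => norm_nonneg _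
  nlinarith [norm_nonneg (overlap (Q j) (Q' j))]

/-- State, observable and predicted sign are all products over the qubits, so the sum over `σ`
becomes a product of one-qubit sums; `2 ^ n` undoes the averaging in `overlap`. -/
theorem sum_expectation_inputState {n : ℕ} (Q Q' : Fin n → Pauli) :
    ∑ σ : Fin n → ℤˣ, sgn (∏ j, if Q j = .I then 1 else σ j) *
      (star (inputState Q σ).1 ⬝ᵥ pauliOp Q' *ᵥ (inputState Q σ).1) =
        2 ^ n * ∏ j, overlap (Q j) (Q' j) := by
  have hσ : ∀ σ : Fin n → ℤˣ, sgn (∏ j, if Q j = .I then 1 else σ j) *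
      (star (inputState Q σ).1 ⬝ᵥ pauliOp Q' *ᵥ (inputState Q σ).1) =
        ∏ j, sgn (if Q j = .I then 1 else σ j) *
          (star (qubitState (Q j) (σ j)) ⬝ᵥ (Q' j).mat *ᵥ qubitState (Q j) (σ j)) := by
    intro σ
    have hs : star (inputState Q σ).1 = fun x => ∏ j, (star (qubitState (Q j) (σ j))) (x j) := by
      ext x; simp [inputState]
    rw [hs, pauliOp, inputState, tensor_mulVec, dotProduct_prod, Finset.prod_mul_distrib]
    simp [sgn, Units.coe_prod]
  rw [Finset.sum_congr rfl fun σ _ => hσ σ]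
  have h := Finset.prod_univ_sum (fun _ : Fin n => (Finset.univ : Finset ℤˣ))
    (fun j s => sgn (if Q j = .I then 1 else s) *
      (star (qubitState (Q j) s) ⬝ᵥ (Q' j).mat *ᵥ qubitState (Q j) s))
  rw [Fintype.piFinset_univ] at h
  rw [← h]
  simp only [overlap, Finset.prod_mul_distrib, Finset.prod_const, Finset.card_univ,
    Fintype.card_fin, ← mul_assoc, ← mul_pow]
  norm_num

/-- If `U` and `V` pull `P` back differently, the average probability of the wrong outcome is
bounded below. -/
theorem le_sum_bornProb {n : ℕ} {U V : UnitaryOp n} (hU : IsClifford (U : Op n))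
    (hV : IsClifford (V : Op n)) {P : Fin n → Pauli}
    (h : (U : Op n)ᴴ * pauliOp P * (U : Op n) ≠ (V : Op n)ᴴ * pauliOp P * (V : Op n)) :
    2 ^ n * (1 / 8 : ℝ) ≤ ∑ σ, bornProb P ((inputState (pullback (U : Op n) P).2 σ).apply V)
      (-predicted (pullback (U : Op n) P) σ) := by
  rw [pullback_spec hU, pullback_spec hV] at h
  set r := pullback (U : Op n) P with hr
  set r' := pullback (V : Op n) P with hr'
  set κ : ℂ := ∏ j, overlap (r.2 j) (r'.2 j) with hκ
  have hsum : ∑ σ, bornProb P ((inputState r.2 σ).apply V) (-predicted r σ) =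
      2 ^ n * ((1 - (sgn r.1 * sgn r'.1 * κ).re) / 2) := by
    have hb : ∀ σ, bornProb P ((inputState r.2 σ).apply V) (-predicted r σ) =
        1 / 2 - (sgn r.1 * sgn r'.1 * (sgn (∏ j, if r.2 j = .I then 1 else σ j) *
      (star (inputState r.2 σ).1 ⬝ᵥ pauliOp r'.2 *ᵥ (inputState r.2 σ).1))).re / 2 := by
      intro σ
      rw [bornProb_eq, expectation_apply, pullback_spec hV, ← hr', smul_mulVec, dotProduct_smul,
        smul_eq_mul]
      have : sgn (-predicted r σ) = -(sgn r.1 * sgn (∏ j, if r.2 j = .I then 1 else σ j)) := by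
        simp [sgn, predicted]
      rw [this]
      have e : ∀ a b c d : ℂ, -(a * b) * (c * d) = -(a * c * (b * d)) := fun a b c d => by ring
      rw [e, Complex.neg_re]
      ring
    rw [Finset.sum_congr rfl fun σ _ => hb σ, Finset.sum_sub_distrib]
    simp only [← Finset.sum_div]
    rw [← Complex.re_sum, ← Finset.mul_sum, sum_expectation_inputState]
    have e : sgn r.1 * sgn r'.1 * (2 ^ n * κ) =
        ((2 ^ n : ℝ) : ℂ) * (sgn r.1 * sgn r'.1 * κ) := by
      push_cast; ring
    rw [← hκ, e, Complex.re_ofReal_mul]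
    simp [Fintype.card_units_int]
    ring
  rw [hsum]
  refine mul_le_mul_of_nonneg_left ?_ (by positivity)
  suffices (sgn r.1 * sgn r'.1 * κ).re ≤ 3 / 4 by linarith
  -- Equal strings force opposite signs, so the correlation is `-1`; different strings fall under
  -- the overlap bound.
  by_cases hQ : r.2 = r'.2
  · have h1 : κ = 1 := by
      rw [hκ, hQ]
      exact Finset.prod_eq_one fun j _ => overlap_self _
    have h2 : r.1 ≠ r'.1 := fun e => h (by rw [e, hQ])
    have h3 : sgn r.1 * sgn r'.1 = -1 := by
      rw [Int.units_ne_iff_eq_neg] at h2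
      have : sgn (-r'.1) = -sgn r'.1 := by simp [sgn]
      rw [h2, this, neg_mul, sgn_mul_self]
    rw [h3, h1]
    norm_num
  · refine (Complex.re_le_norm _).trans ?_
    have hs : ∀ s : ℤˣ, ‖sgn s‖ = 1 := fun s => by
      rcases Int.units_eq_one_or s with rfl | rfl <;> simp [sgn]
    rw [norm_mul, norm_mul, hs, hs, one_mul, one_mul]
    exact norm_prod_overlap_le hQ

/-! ### Counting the Paulis that tell two channels apart -/

/-- This turns agreement of the pullbacks into membership in a commutant, which is closed under
products and linear combinations. -/
theorem pullback_eq_iff_commute {n : ℕ} {U V : UnitaryOp n} {M : Op n} :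
    (U : Op n)ᴴ * M * (U : Op n) = (V : Op n)ᴴ * M * (V : Op n) ↔
      Commute ((V : Op n) * (U : Op n)ᴴ) M := by
  have hU := conjTranspose_mul_self U
  have hU' := mul_conjTranspose_self U
  have hV := conjTranspose_mul_self V
  have hV' := mul_conjTranspose_self V
  constructor
  · intro h
    calc (V : Op n) * (U : Op n)ᴴ * M
        = V * ((U : Op n)ᴴ * M * U) * (U : Op n)ᴴ := by
          simp only [Matrix.mul_assoc, hU', Matrix.mul_one]
      _ = ((V : Op n) * (V : Op n)ᴴ) * M * (V * (U : Op n)ᴴ) := by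
          rw [h]; simp only [Matrix.mul_assoc]
      _ = M * (V * (U : Op n)ᴴ) := by rw [hV', Matrix.one_mul]
  · intro h
    calc (U : Op n)ᴴ * M * (U : Op n)
        = ((V : Op n)ᴴ * V) * (U : Op n)ᴴ * M * (U : Op n) := by rw [hV, Matrix.one_mul]
      _ = (V : Op n)ᴴ * ((V * (U : Op n)ᴴ) * M) * (U : Op n) := by simp only [Matrix.mul_assoc]
      _ = (V : Op n)ᴴ * M * (V : Op n) := by
          rw [h.eq]; simp only [Matrix.mul_assoc, hU, Matrix.mul_one]

theorem exists_pullback_ne {n : ℕ} {U V : UnitaryOp n} (h : ¬ SameChannel (U : Op n) (V : Op n)) :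
    ∃ P : Fin n → Pauli,
      (U : Op n)ᴴ * pauliOp P * (U : Op n) ≠ (V : Op n)ᴴ * pauliOp P * (V : Op n) := by
  by_contra! hall
  refine h fun ρ _ _ => ?_
  -- `V U†` then commutes with every operator, in particular with `U ρ U†`.
  have hc := commute_of_commute_pauliOp (fun P => pullback_eq_iff_commute.1 (hall P))
    ((U : Op n) * ρ * (U : Op n)ᴴ)
  have := pullback_eq_iff_commute.2 hc
  rw [conjTranspose_conj] at this
  conv_rhs => rw [this]
  have hV' := mul_conjTranspose_self V
  calc (U : Op n) * ρ * (U : Op n)ᴴ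
      = ((V : Op n) * (V : Op n)ᴴ) * (U * ρ * (U : Op n)ᴴ) * (V * (V : Op n)ᴴ) := by
        rw [hV', Matrix.one_mul, Matrix.mul_one]
    _ = _ := by simp only [Matrix.mul_assoc]

/-- At least half of the Paulis are pulled back differently by different channels. -/
theorem exists_finset_pullback_ne {n : ℕ} {U V : UnitaryOp n}
    (h : ¬ SameChannel (U : Op n) (V : Op n)) :
    ∃ S : Finset (Fin n → Pauli), Fintype.card (Fin n → Pauli) ≤ 2 * S.card ∧ ∀ P ∈ S,
      (U : Op n)ᴴ * pauliOp P * (U : Op n) ≠ (V : Op n)ᴴ * pauliOp P * (V : Op n) := by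
  classical
  obtain ⟨R, hR⟩ := exists_pullback_ne h
  let T : Finset (Fin n → Pauli) := Finset.univ.filter fun P =>
    (U : Op n)ᴴ * pauliOp P * (U : Op n) = (V : Op n)ᴴ * pauliOp P * (V : Op n)
  have hT : ∀ P, P ∈ T ↔ Commute ((V : Op n) * (U : Op n)ᴴ) (pauliOp P) := fun P => by
    rw [← pullback_eq_iff_commute]; simp [T]
  refine ⟨Tᶜ, ?_, fun P hP e => Finset.mem_compl.1 hP (by simpa [T] using e)⟩
  -- If `P` and `R P` both commuted with `V U†`, so would `R`, a multiple of `(R P) P`.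
  have hle : T.card ≤ Tᶜ.card := by
    refine Finset.card_le_card_of_injOn (fun P j => (R j).mul (P j)) (fun P hP => ?_)
      fun P _ P' _ e => ?_
    · rw [Finset.mem_coe, hT] at hP
      rw [Finset.mem_coe, Finset.mem_compl, hT]
      intro hRP
      refine hR (pullback_eq_iff_commute.2 ?_)
      obtain ⟨c, hc⟩ := exists_pauliOp_mul R P
      have : pauliOp R = c • pauliOp (fun j => (R j).mul (P j)) * pauliOp P := by
        rw [← hc, Matrix.mul_assoc, pauliOp_mul_self, Matrix.mul_one]
      rw [this]
      exact (hRP.smul_right c).mul_right hP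
    · funext j
      exact Pauli.mul_left_injective (R j) (congrFun e j)
  have := Finset.card_add_card_compl T
  omega

/-! ### The distribution of the test -/

theorem measurePauli_toMeasure_singleton {n : ℕ} (P : Fin n → Pauli) (φ : PureState n) (m : ℤˣ) :
    (measurePauli P φ).toMeasure {m} = ENNReal.ofReal (bornProb P φ m) := by
  rw [PMF.toMeasure_apply_singleton _ _ (measurableSet_singleton m)]
  rfl

/-- The probability that the outcome is `ε` times the predicted value. -/
theorem test_real_eq {n : ℕ} (U V : UnitaryOp n) (ε : ℤˣ) :
    (test U V).toMeasure.real {r | r.2 = ε * r.1} =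
      (Fintype.card (Fin n → Pauli) : ℝ)⁻¹ * ∑ P, (2 ^ n : ℝ)⁻¹ * ∑ σ,
        bornProb P ((inputState (pullback (U : Op n) P).2 σ).apply V)
          (ε * predicted (pullback (U : Op n) P) σ) := by
  have hmap : ∀ (P : Fin n → Pauli) (φ : PureState n) (t : ℤˣ),
      ((measurePauli P φ).map fun m => (t, m)).toMeasure {r | r.2 = ε * r.1} =
        ENNReal.ofReal (bornProb P φ (ε * t)) := by
    intro P φ t
    rw [PMF.toMeasure_map_apply _ _ _ (by fun_prop) (MeasurableSet.of_discrete),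
      ← measurePauli_toMeasure_singleton]
    rfl
  rw [Measure.real, test, PMF.toMeasure_bind_apply _ _ _ MeasurableSet.of_discrete, tsum_fintype,
    ENNReal.toReal_sum (fun P _ => ENNReal.mul_ne_top (PMF.apply_ne_top _ _) (measure_ne_top _ _)),
    Finset.mul_sum]
  refine Finset.sum_congr rfl fun P _ => ?_
  rw [PMF.toMeasure_bind_apply _ _ _ MeasurableSet.of_discrete, tsum_fintype, ENNReal.toReal_mul,
    ENNReal.toReal_sum (fun P _ => ENNReal.mul_ne_top (PMF.apply_ne_top _ _) (measure_ne_top _ _)),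
    Finset.mul_sum (a := (2 ^ n : ℝ)⁻¹)]
  congr 1
  · simp
  · refine Finset.sum_congr rfl fun σ _ => ?_
    rw [hmap, ENNReal.toReal_mul, ENNReal.toReal_ofReal (bornProb_nonneg _ _ _)]
    simp

theorem SameChannel.test_real_eq_one {n : ℕ} {U V : UnitaryOp n} (hU : IsClifford (U : Op n))
    (h : SameChannel (U : Op n) (V : Op n)) :
    (test U V).toMeasure.real {r | r.2 = r.1} = 1 := by
  have := test_real_eq U V 1
  simp only [one_mul] at this
  rw [this]
  simp [h.bornProb_eq_one hU]

/-- At least half of the Paulis contribute at least `1/8` each; the others contribute a nonnegative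
amount. -/
theorem le_test_real {n : ℕ} {U V : UnitaryOp n} (hU : IsClifford (U : Op n))
    (hV : IsClifford (V : Op n)) (h : ¬ SameChannel (U : Op n) (V : Op n)) :
    1 / 16 ≤ (test U V).toMeasure.real {r | r.2 = -r.1} := by
  have ht := test_real_eq U V (-1)
  simp only [neg_one_mul] at ht
  rw [ht]
  obtain ⟨S, hS, hne⟩ := exists_finset_pullback_ne h
  set f : (Fin n → Pauli) → ℝ := fun P => (2 ^ n : ℝ)⁻¹ * ∑ σ,
    bornProb P ((inputState (pullback (U : Op n) P).2 σ).apply V)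
      (-predicted (pullback (U : Op n) P) σ) with hf
  have hf0 : ∀ P, 0 ≤ f P := fun P =>
    mul_nonneg (by positivity) (Finset.sum_nonneg fun σ _ => bornProb_nonneg _ _ _)
  have hf1 : ∀ P ∈ S, 1 / 8 ≤ f P := fun P hP => by
    rw [hf, le_inv_mul_iff₀ (by positivity)]
    exact le_sum_bornProb hU hV (hne P hP)
  have hsum : S.card * (1 / 8 : ℝ) ≤ ∑ P, f P :=
    calc S.card * (1 / 8 : ℝ) = ∑ P ∈ S, (1 / 8 : ℝ) := by simp
      _ ≤ ∑ P ∈ S, f P := Finset.sum_le_sum hf1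
      _ ≤ ∑ P, f P := Finset.sum_le_univ_sum_of_nonneg hf0
  have hS' : (Fintype.card (Fin n → Pauli) : ℝ) ≤ 2 * S.card := by exact_mod_cast hS
  rw [le_inv_mul_iff₀ (by exact_mod_cast Fintype.card_pos)]
  linarith

/-! ### Repeated runs -/

/-- Nothing is detected exactly when every run agrees with its prediction, a product event under the
product measure. -/
theorem repeatedTest_real_detected {n : ℕ} (U V : UnitaryOp n) (k : ℕ) :
    (repeatedTest U V k).real (detected k) =
      1 - (test U V).toMeasure.real {r | r.2 = r.1} ^ k := by
  have : IsProbabilityMeasure (repeatedTest U V k) := by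
    unfold repeatedTest; infer_instance
  have hc : (detected k)ᶜ = Set.univ.pi fun _ : Fin k => {r : ℤˣ × ℤˣ | r.2 = r.1} := by
    ext ω; simp [detected, Set.mem_pi]
  rw [← compl_compl (detected k), probReal_compl_eq_one_sub MeasurableSet.of_discrete, hc]
  congr 1
  simp [Measure.real, repeatedTest, Measure.pi_pi]

theorem test_real_eq_one_sub {n : ℕ} (U V : UnitaryOp n) :
    (test U V).toMeasure.real {r | r.2 = r.1} =
      1 - (test U V).toMeasure.real {r | r.2 = -r.1} := by
  have hc : {r : ℤˣ × ℤˣ | r.2 = r.1} = {r | r.2 = -r.1}ᶜ := by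
    ext r
    simp only [Set.mem_ofPred_eq, Set.mem_compl_iff, ← Int.units_ne_iff_eq_neg, not_not]
  rw [hc, probReal_compl_eq_one_sub MeasurableSet.of_discrete]

theorem pow_le_of_log_le {p δ : ℝ} (hp : p ≤ 15 / 16) (hp0 : 0 ≤ p) (hδ : 0 < δ) {k : ℕ}
    (hk : 16 * Real.log (1 / δ) ≤ k) : p ^ k ≤ δ :=
  calc p ^ k ≤ Real.exp (-(1 / 16)) ^ k := by
        refine pow_le_pow_left₀ hp0 ?_ k
        -- `15/16 = 1 - 1/16 ≤ exp (-1/16)`.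
        have := Real.add_one_le_exp (-(1 / 16) : ℝ)
        linarith
    _ = Real.exp (-(k / 16)) := by rw [← Real.exp_nat_mul]; ring_nf
    _ ≤ Real.exp (Real.log δ) := by
        refine Real.exp_le_exp.2 ?_
        rw [one_div, Real.log_inv] at hk
        linarith
    _ = δ := Real.exp_log hδ

end CliffordTest

theorem mainTheorem2 :
    -- every circuit of Pauli, Hadamard, phase and CNOT gates is a Clifford unitary
    (∀ (n : ℕ) (gates : List (Gate n)), IsClifford (circuitMat gates)) ∧
    -- the constants do not depend on the number of qubits or on the unitaries
    ∃ c C : ℝ, 0 < c ∧ 0 < C ∧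
      ∀ (n : ℕ) (U V : UnitaryOp n), IsClifford (U : Op n) → IsClifford (V : Op n) →
        -- `U† P U` is the signed Pauli that the test works with
        (∀ P : Fin n → Pauli,
          (U : Op n)ᴴ * pauliOp P * (U : Op n) =
            sgn (pullback (U : Op n) P).1 • pauliOp (pullback (U : Op n) P).2) ∧
        -- the input state is an eigenstate of it, with the predicted eigenvalue
        (∀ (P : Fin n → Pauli) (σ : Fin n → ℤˣ),
          ((U : Op n)ᴴ * pauliOp P * (U : Op n)) *ᵥ (inputState (pullback (U : Op n) P).2 σ).1 =
            sgn (predicted (pullback (U : Op n) P) σ) •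
              (inputState (pullback (U : Op n) P).2 σ).1) ∧
        -- equal channels: the outcome is the predicted one, and no difference is ever reported
        (SameChannel (U : Op n) (V : Op n) →
          (test U V).toMeasure.real {r | r.2 = r.1} = 1 ∧
          ∀ k : ℕ, (repeatedTest U V k).real (detected k) = 0) ∧
        -- different channels: constant probability of the opposite outcome in one run,
        -- and detection with probability at least `1 - δ` after `O(log (1/δ))` runs
        (¬ SameChannel (U : Op n) (V : Op n) →
          c ≤ (test U V).toMeasure.real {r | r.2 = -r.1} ∧
          ∀ δ : ℝ, 0 < δ → δ < 1 → ∀ k : ℕ, C * Real.log (1 / δ) ≤ k →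
            1 - δ ≤ (repeatedTest U V k).real (detected k)) := by
  refine ⟨fun n gates => isClifford_circuitMat gates, 1 / 16, 16, by norm_num, by norm_num,
    fun n U V hU hV => ⟨pullback_spec hU, pullback_mulVec_inputState hU, fun h => ⟨?_, fun k => ?_⟩,
      fun h => ⟨le_test_real hU hV h, fun δ hδ _ k hk => ?_⟩⟩⟩
  · exact h.test_real_eq_one hU
  · rw [repeatedTest_real_detected, h.test_real_eq_one hU, one_pow, sub_self]
  · rw [repeatedTest_real_detected]
    refine sub_le_sub_left (pow_le_of_log_le ?_ measureReal_nonneg hδ hk) 1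
    rw [test_real_eq_one_sub]
    linarith [le_test_real hU hV h]
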